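/- **Definitions.** An *LZ-like encoding* of a string $T$ of length $n$ is a decomposition of $T$ into phrases, each of which is either a single symbol, encoded as $(1,a)$, or has length $\ell\ge 2$ and is encoded as $(\ell,s)$, where $s$ is a previous occurrence of the phrase (a position $s<b$ with $T[s..s+\ell)=T[b..b+\ell)$, where $b$ is the starting position of the phrase; the two factors may overlap). Its *size* is the number of phrases. The *height* of a position in a phrase of length $1$ is $0$; the height of a position $i$ in a phrase $(\ell,s)$ starting at $b$ is one plus the height of the position $s+((i-b)\bmod(b-s))$. For real $h\ge 0$, $z_{\mathrm{HB}}(h)$ is the smallest size of an LZ-like encoding of $T$ all of whose positions have height at most $h$. The *LZ77 parsing* is obtained greedily from left to right, always taking the longest possible phrase; $z$ is its number of phrases. An *RLSLP* is an acyclic grammar with one rule per variable, each of the form $A\to a$ (size $1$), $A\to BC$ (size $2$) or $A\to B^t$ with $t>2$ (size $2$). For an integer $d\ge 0$, an *ISLP of degree $d$* is an acyclic grammar with one rule per variable, each of the form $A\to a$ (size $1$), $A\to BC$ (size $2$) or $A\to\prod_{i=k_1}^{k_2}B_1^{i^{c_1}}\cdots B_t^{i^{c_t}}$ with $k_1,k_2,t\ge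 1$ and $0\le c_1,\dots,c_t\le d$ (size $2+2t$; the index $i$ descends if $k_1>k_2$). The size of a grammar is the sum of the sizes of its rules; $\hat g_{\mathrm{rl}}$ and $g_{it(d)}$ are the smallest sizes of an RLSLP and of an ISLP of degree $d$ generating the string. Let $t(k)$ be the length-$k$ prefix of the Thue–Morse word. Logarithms are to base $2$. **Theorem.** There are an infinite family of strings $$\hat s=t(k_1)\,\#_1\,t(k_2)\,\#_2\cdots\#_{p-1}\,t(k_p),$$ one for each $m\in\mathbb N$, with $p=p(m)\ge 1$, positive integers $k_i=k_i(m)$ and distinct separators $\#_i$ that do not occur in the Thue–Morse word, where $k_1$ is the largest of the $k_i$, $k_1\to\infty$ as $m\to\infty$ and $p=\Theta(\log k_1)$, and a constant $c>0$, such that, with $n=|\hat s|$ and asymptotically as $m\to\infty$: 1. $z=O(\log k_1)$ and $z_{\mathrm{HB}}(c\log n)=O(\log k_1)$; 2. $\hat g_{\mathrm{rl}}=\Omega\!\left(\frac{\log^2 k_1}{\log\log k_1}\right)$, and $g_{it(d)}=\Omega\!\left(\frac{\log^2 k_1}{\log\log k_1}\right)$ uniformly in $d\ge 0$; 3. $z_{\mathrm{HB}}(c\log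 n)=o(\hat g_{\mathrm{rl}})$, and $z_{\mathrm{HB}}(c\log n)=o(g_{it(d)})$ for every $d\ge 0$. -/

import Mathlib

open Filter Asymptotics

/-! ### LZ-like encodings -/

/-- A phrase of an LZ-like encoding: `literal a` is the pair `(1, a)`, and `copy ℓ s` is the pair
`(ℓ, s)` of a length and a source position. Positions of strings are counted from `0`. -/
inductive LZPhrase (α : Type) : Type
  | literal (a : α) : LZPhrase α
  | copy (len src : ℕ) : LZPhrase α

/-- The length of a phrase. -/
def LZPhrase.length {α : Type} : LZPhrase α → ℕ
  | .literal _ => 1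
  | .copy len _ => len

/-- The starting position of the `j`-th phrase. -/
def phraseStart {α : Type} (E : List (LZPhrase α)) (j : ℕ) : ℕ :=
  ((E.take j).map LZPhrase.length).sum

/-- The factors of length `len` of `w` that start at `i` and at `i'` coincide (it is used only when
both lie inside `w`). Both factors may overlap. -/
def SameFactor {α : Type} (w : List α) (i i' len : ℕ) : Prop :=
  ∀ r < len, w[i + r]? = w[i' + r]?

/-- The phrase `x` may start at position `b` of an LZ-like encoding of `w`: it is a single
symbol, or it has length at least `2` and its source is a previous occurrence (possibly
overlapping the phrase). -/
def LZPhrase.ValidAt {α : Type} (w : List α) (b : ℕ) : LZPhrase α → Prop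
  | .literal a => w[b]? = some a
  | .copy len src => 2 ≤ len ∧ src < b ∧ SameFactor w src b len

/-- `E` is an LZ-like encoding of `w`. -/
def IsLZEncoding {α : Type} (E : List (LZPhrase α)) (w : List α) : Prop :=
  (E.map LZPhrase.length).sum = w.length ∧
    ∀ (j : ℕ) (hj : j < E.length), (E[j]).ValidAt w (phraseStart E j)

/-- Given the heights `H` of all positions before a phrase (so that the phrase starts at
`b = H.length`), append the heights of the positions of the phrase: a literal has height `0`, and
the position `b + r` of a copy with source `s` refers to the position `s + r mod (b - s)`. -/
def appendHeights {α : Type} (H : List ℕ) : LZPhrase α → List ℕ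
  | .literal _ => H ++ [0]
  | .copy len src =>
      H ++ (List.range len).map fun r => H.getD (src + r % (H.length - src)) 0 + 1

/-- The list of the heights of all positions in the referencing forest of an encoding. -/
def heights {α : Type} (E : List (LZPhrase α)) : List ℕ :=
  E.foldl appendHeights []

/-- All heights are at most `h`. -/
def HeightBounded {α : Type} (E : List (LZPhrase α)) (h : ℝ) : Prop :=
  ∀ x ∈ heights E, (x : ℝ) ≤ h

/-- The smallest size (number of phrases) of an LZ-like encoding of `w` of height at most `h`. -/
noncomputable def zHB {α : Type} (w : List α) (h : ℝ) : ℕ :=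
  sInf {z : ℕ | ∃ E : List (LZPhrase α), IsLZEncoding E w ∧ HeightBounded E h ∧ E.length = z}

/-! ### The LZ77 parsing -/

/-- The factor of length `len` at position `b` of `w` can be a phrase of an LZ-like parsing. -/
def CanBePhrase {α : Type} (w : List α) (b len : ℕ) : Prop :=
  b + len ≤ w.length ∧ (len = 1 ∨ (2 ≤ len ∧ ∃ src < b, SameFactor w src b len))

/-- The length of the greedy (longest possible) phrase at position `b`. -/
noncomputable def lz77PhraseLength {α : Type} (w : List α) (b : ℕ) : ℕ :=
  sSup {len : ℕ | CanBePhrase w b len}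

theorem lz77PhraseLength_pos {α : Type} (w : List α) (b : ℕ) (hb : b < w.length) :
    1 ≤ lz77PhraseLength w b :=
  le_csSup ⟨w.length, fun _ h => le_trans (Nat.le_add_left _ _) h.1⟩ ⟨hb, Or.inl rfl⟩

/-- The number of phrases of the greedy left-to-right parsing of the part of `w` that starts at
position `b`. -/
noncomputable def lz77SizeFrom {α : Type} (w : List α) (b : ℕ) : ℕ :=
  if hb : b < w.length then lz77SizeFrom w (b + lz77PhraseLength w b) + 1 else 0
termination_by w.length - b
decreasing_by
  have := lz77PhraseLength_pos w b hb
  omega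

/-- The size of the LZ77 parsing of `w`. -/
noncomputable def lz77Size {α : Type} (w : List α) : ℕ := lz77SizeFrom w 0

/-! ### Run-length straight-line programs -/

/-- The right-hand side of a rule `A → a`, `A → B C` or `A → B ^ t`. -/
inductive RLRule (α : Type) : Type
  | terminal (a : α) : RLRule α
  | binary (B C : ℕ) : RLRule α
  | run (B t : ℕ) : RLRule α

/-- The size of a rule; a run-length rule has size `2`. -/
def RLRule.size {α : Type} : RLRule α → ℕ
  | .terminal _ => 1
  | .binary _ _ => 2
  | .run _ _ => 2

/-- The rule is allowed for the `N`-th variable: it uses only variables with smaller numbers (so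
no variable can reach itself), and the exponent of a run-length rule is larger than `2`. -/
def RLRule.Valid {α : Type} (N : ℕ) : RLRule α → Prop
  | .terminal _ => True
  | .binary B C => B < N ∧ C < N
  | .run B t => B < N ∧ 2 < t

/-- The string generated by a rule, where `X` lists the strings of the earlier variables. -/
def RLRule.expand {α : Type} (X : List (List α)) : RLRule α → List α
  | .terminal a => [a]
  | .binary B C => X.getD B [] ++ X.getD C []
  | .run B t => (List.replicate t (X.getD B [])).flatten

/-- The strings generated by the variables `0, 1, 2, …` of a run-length straight-line program,
whose `j`-th entry is the rule of the variable `j`. -/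
def rlExpansions {α : Type} (G : List (RLRule α)) : List (List α) :=
  G.foldl (fun X R => X ++ [R.expand X]) []

/-- `G` is a run-length straight-line program that generates `w` from one of its variables. -/
def IsRLSLP {α : Type} (G : List (RLRule α)) (w : List α) : Prop :=
  (∀ (j : ℕ) (hj : j < G.length), (G[j]).Valid j) ∧ w ∈ rlExpansions G

/-- The size of the smallest run-length straight-line program that generates `w`. -/
noncomputable def gRL {α : Type} (w : List α) : ℕ :=
  sInf {g : ℕ | ∃ G : List (RLRule α), IsRLSLP G w ∧ (G.map RLRule.size).sum = g}

/-! ### Iterated straight-line programs -/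

/-- The right-hand side of a rule `A → a`, `A → B C`, or of an iteration rule
`A → ∏_{i = k₁}^{k₂} B₁ ^ (i ^ c₁) ⋯ B_t ^ (i ^ c_t)`, where the pairs `(B_j, c_j)` are listed in
`body`. -/
inductive ItRule (α : Type) : Type
  | terminal (a : α) : ItRule α
  | binary (B C : ℕ) : ItRule α
  | iter (k₁ k₂ : ℕ) (body : List (ℕ × ℕ)) : ItRule α

/-- The size of a rule; an iteration rule with `t` factors has size `2 + 2 t`. -/
def ItRule.size {α : Type} : ItRule α → ℕ
  | .terminal _ => 1
  | .binary _ _ => 2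
  | .iter _ _ body => 2 + 2 * body.length

/-- The rule is allowed for the `N`-th variable of an iterated straight-line program of
degree `d`: it uses only variables with smaller numbers, and in an iteration rule the bounds of the
iteration are positive, there is at least one factor and `c_j ≤ d` for all `j`. -/
def ItRule.Valid {α : Type} (d N : ℕ) : ItRule α → Prop
  | .terminal _ => True
  | .binary B C => B < N ∧ C < N
  | .iter k₁ k₂ body => 1 ≤ k₁ ∧ 1 ≤ k₂ ∧ body ≠ [] ∧ ∀ q ∈ body, q.1 < N ∧ q.2 ≤ d

/-- The indices of the iteration from `k₁` to `k₂`, in descending order when `k₂ < k₁`. -/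
def iterRange (k₁ k₂ : ℕ) : List ℕ :=
  if k₁ ≤ k₂ then List.range' k₁ (k₂ - k₁ + 1) else (List.range' k₂ (k₁ - k₂ + 1)).reverse

/-- The string generated by a rule, where `X` lists the strings of the earlier variables. -/
def ItRule.expand {α : Type} (X : List (List α)) : ItRule α → List α
  | .terminal a => [a]
  | .binary B C => X.getD B [] ++ X.getD C []
  | .iter k₁ k₂ body =>
      (iterRange k₁ k₂).flatMap fun i =>
        body.flatMap fun q => (List.replicate (i ^ q.2) (X.getD q.1 [])).flatten

/-- The strings generated by the variables of an iterated straight-line program. -/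
def itExpansions {α : Type} (G : List (ItRule α)) : List (List α) :=
  G.foldl (fun X R => X ++ [R.expand X]) []

/-- `G` is an iterated straight-line program of degree `d` that generates `w` from one of its
variables. -/
def IsISLP {α : Type} (d : ℕ) (G : List (ItRule α)) (w : List α) : Prop :=
  (∀ (j : ℕ) (hj : j < G.length), (G[j]).Valid d j) ∧ w ∈ itExpansions G

/-- The size of the smallest iterated straight-line program of degree `d` that generates `w`. -/
noncomputable def gIt {α : Type} (d : ℕ) (w : List α) : ℕ :=
  sInf {g : ℕ | ∃ G : List (ItRule α), IsISLP d G w ∧ (G.map ItRule.size).sum = g}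

/-! ### The strings -/

/-- The `n`-th symbol of the Thue–Morse word: the parity of the binary digit sum of `n`. -/
def thueMorse (n : ℕ) : Bool := (Nat.digits 2 n).sum % 2 == 1

/-- The prefix of length `k` of the Thue–Morse word, over an alphabet that contains infinitely many
further symbols `Sum.inr i`. -/
def tmPrefix (k : ℕ) : List (Bool ⊕ ℕ) := (List.range k).map fun n => Sum.inl (thueMorse n)

/-- The string `t(k₁) #₁ t(k₂) #₂ ⋯ #_{p-1} t(k_p)` for `1 ≤ p`, with `#_i = Sum.inr i`. -/
def separatedPrefixes (k : ℕ → ℕ) (p : ℕ) : List (Bool ⊕ ℕ) :=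
  tmPrefix (k 1) ++
    (List.range (p - 1)).flatMap fun i => Sum.inr (i + 1) :: tmPrefix (k (i + 2))

/-!
The family has `k 1 = 2 ^ L` and `p = L + 1` with `L = m + 2`; the lengths `k 2, …, k p` are found by
counting.

*Upper bounds.* The first `2 ^ L` symbols of the Thue–Morse word have an LZ-like encoding by `2 L`
phrases, since `t t' t' t` follows from `t t'` by two copies (`exists_encodesPrefix_thueMorse`).
Every further segment is a copy of a prefix, and with its separator costs two phrases. Copying
raises heights by at most one, so any encoding by `O(log n)` phrases has height `O(log n)`
(`le_length_of_mem_heights`). The greedy parsing is at most as long as any encoding, because a suffix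
of a phrase can be a phrase (`lz77Size_le`).

*Lower bounds.* The Thue–Morse word is cube-free (`not_thueMorse_cube`), and hence so are the strings
of the family, as every separator occurs once. In a cube-free string, iteration rules are useless: such
a rule has at most two rounds, in which every power is at most a square (`iter_bounds`), so that it is
a plain product of length linear in its size. Thus a grammar of size `g`, whatever its degree, can be
written as a word of length `2 g + 1` over an alphabet of `O(g + p)` tokens
(`IsISLP.exists_slpEval_eq`), and at most `(g + L) ^ O(g)` strings have such grammars. The string
determines its segment lengths, which can be chosen in `2 ^ (L * L)` ways, so for some choice every
grammar has size of order at least `L ^ 2 / log L` (`exists_segmentLengths`). A run-length rule is an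
iteration rule with exponent zero, which reduces run-length programs to iterated ones.
-/

/-! ### The Thue–Morse word is cube-free -/

theorem thueMorse_two_mul (n : ℕ) : thueMorse (2 * n) = thueMorse n := by
  rcases Nat.eq_zero_or_pos n with rfl | hn
  · rfl
  · simp [thueMorse, Nat.digits_def' (b := 2) (by norm_num) (by omega : 0 < 2 * n)]

theorem thueMorse_two_mul_add_one (n : ℕ) : thueMorse (2 * n + 1) = !thueMorse n := by
  have h : Nat.digits 2 (2 * n + 1) = 1 :: Nat.digits 2 n := by
    rw [Nat.digits_def' (b := 2) (by norm_num) (by omega)]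
    congr 2 <;> omega
  simp only [thueMorse, h, List.sum_cons]
  rcases Nat.mod_two_eq_zero_or_one (Nat.digits 2 n).sum with h | h
  · simp [Nat.add_mod, h]
  · simp [Nat.add_mod, h]

/-- No three consecutive symbols of the Thue–Morse word are equal, since the positions `2n` and
`2n + 1` carry different symbols. -/
theorem not_thueMorse_run_three (n : ℕ) :
    ¬(thueMorse n = thueMorse (n + 1) ∧ thueMorse (n + 1) = thueMorse (n + 2)) := by
  rintro ⟨h₁, h₂⟩
  obtain ⟨k, rfl | rfl⟩ := Nat.even_or_odd' n
  · rw [thueMorse_two_mul, thueMorse_two_mul_add_one] at h₁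
    cases h : thueMorse k <;> simp [h] at h₁
  · rw [show 2 * k + 1 + 1 = 2 * (k + 1) by ring, show 2 * k + 1 + 2 = 2 * (k + 1) + 1 by ring,
      thueMorse_two_mul, thueMorse_two_mul_add_one] at h₂
    cases h : thueMorse (k + 1) <;> simp [h] at h₂

/-- The Thue–Morse word has no cube of period `l`. A cube of even period descends to one of half
the period; a cube of odd period at least `3` forces three equal consecutive symbols. -/
theorem not_thueMorse_cube (l : ℕ) (hl : 0 < l) (i : ℕ) :
    ¬∀ r, i ≤ r → r < i + 2 * l → thueMorse r = thueMorse (r + l) := by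
  induction l using Nat.strong_induction_on generalizing i with
  | _ l ih =>
    intro h
    obtain ⟨k, rfl | rfl⟩ := Nat.even_or_odd' l
    · refine ih k (by omega) (by omega) ((i + 1) / 2) fun r h₁ h₂ => ?_
      have := h (2 * r) (by omega) (by omega)
      rwa [← Nat.mul_add, thueMorse_two_mul, thueMorse_two_mul] at this
    · rcases Nat.eq_zero_or_pos k with rfl | hk
      · exact not_thueMorse_run_three i
          ⟨h i le_rfl (by omega), h (i + 1) (by omega) (by omega)⟩
      -- Around an even position `2a` of the window, the factor `t(2a) t(2a+1)` is not constant,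
      -- and neither is its copy at the odd position `2(a+k)+1`.
      · have key : ∀ a, i ≤ 2 * a → 2 * a + 1 < i + 2 * (2 * k + 1) →
            thueMorse (a + k) = thueMorse (a + k + 1) := by
          intro a h₁ h₂
          have e₁ := h (2 * a) h₁ (by omega)
          have e₂ := h (2 * a + 1) (by omega) h₂
          rw [show 2 * a + (2 * k + 1) = 2 * (a + k) + 1 by ring, thueMorse_two_mul,
            thueMorse_two_mul_add_one] at e₁
          rw [show 2 * a + 1 + (2 * k + 1) = 2 * (a + k + 1) by ring, thueMorse_two_mul,
            thueMorse_two_mul_add_one] at e₂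
          rw [← e₂, e₁, Bool.not_not]
        have e₁ := key ((i + 1) / 2) (by omega) (by omega)
        have e₂ := key ((i + 1) / 2 + 1) (by omega) (by omega)
        refine not_thueMorse_run_three ((i + 1) / 2 + k) ⟨e₁, ?_⟩
        rwa [show (i + 1) / 2 + 1 + k = (i + 1) / 2 + k + 1 by ring] at e₂

/-! ### Cube-freeness of the separated strings -/

/-- The word `w` has no factor `uuu` with `u` nonempty. -/
def CubeFree {α : Type} (w : List α) : Prop :=
  ∀ u : List α, u ≠ [] → ¬(u ++ u ++ u) <:+: w

theorem CubeFree.of_infix {α : Type} {v w : List α} (hw : CubeFree w) (h : v <:+: w) :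
    CubeFree v :=
  fun u hu hi => hw u hu (hi.trans h)

@[simp]
theorem length_tmPrefix (k : ℕ) : (tmPrefix k).length = k := by
  simp [tmPrefix]

theorem tmPrefix_getElem? {k r : ℕ} (h : r < k) :
    (tmPrefix k)[r]? = some (Sum.inl (thueMorse r)) := by
  simp [tmPrefix, h]

theorem inr_notMem_tmPrefix (k i : ℕ) : Sum.inr i ∉ tmPrefix k := by
  simp [tmPrefix]

theorem cubeFree_tmPrefix (k : ℕ) : CubeFree (tmPrefix k) := by
  rintro u hu ⟨s, t, h⟩
  have hl : 0 < u.length := List.length_pos_iff.2 hu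
  have hlen := congrArg List.length h
  simp only [List.length_append, length_tmPrefix] at hlen
  have hget : ∀ r, r < 3 * u.length →
      (tmPrefix k)[s.length + r]? = (u ++ u ++ u)[r]? := by
    intro r hr
    rw [← h, List.append_assoc s, List.getElem?_append_right (by omega),
      List.getElem?_append_left (by simp; omega)]
    congr 1
    omega
  refine not_thueMorse_cube u.length hl s.length fun r h₁ h₂ => ?_
  obtain ⟨r, rfl⟩ := Nat.exists_eq_add_of_le h₁
  have e₁ := hget r (by omega)
  have e₂ := hget (r + u.length) (by omega)
  rw [← Nat.add_assoc, tmPrefix_getElem? (by omega)] at e₂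
  rw [tmPrefix_getElem? (by omega)] at e₁
  have e₃ : (u ++ u ++ u)[r]? = (u ++ u ++ u)[r + u.length]? := by
    rw [List.append_assoc, List.getElem?_append_right (l₁ := u) (i := r + u.length) (by omega),
      Nat.add_sub_cancel, ← List.append_assoc, List.getElem?_append_left (by simp; omega)]
  rw [← e₁, ← e₂] at e₃
  simpa using e₃

theorem separatedPrefixes_one (k : ℕ → ℕ) : separatedPrefixes k 1 = tmPrefix (k 1) := by
  simp [separatedPrefixes]

theorem separatedPrefixes_succ (k : ℕ → ℕ) (q : ℕ) :
    separatedPrefixes k (q + 2) =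
      separatedPrefixes k (q + 1) ++ Sum.inr (q + 1) :: tmPrefix (k (q + 2)) := by
  simp [separatedPrefixes, List.range_succ, List.append_assoc]

/-- The separators of `separatedPrefixes k (q + 1)` are `1, …, q`, in this order. -/
theorem filterMap_getRight?_separatedPrefixes (k : ℕ → ℕ) (q : ℕ) :
    (separatedPrefixes k (q + 1)).filterMap Sum.getRight? = List.range' 1 q := by
  have htm : ∀ j, (tmPrefix j).filterMap Sum.getRight? = [] := by
    simp [tmPrefix, List.filterMap_map, List.filterMap_eq_nil_iff]
  induction q with
  | zero => rw [separatedPrefixes_one, htm, List.range'_zero]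
  | succ q ih =>
    rw [separatedPrefixes_succ, List.filterMap_append, ih,
      List.filterMap_cons_some (f := Sum.getRight?) (b := q + 1) rfl, htm,
      List.range'_concat, Nat.one_mul, Nat.add_comm]

theorem lt_of_inr_mem_separatedPrefixes (k : ℕ → ℕ) (q i : ℕ)
    (h : Sum.inr i ∈ separatedPrefixes k (q + 1)) : i < q + 1 := by
  have : i ∈ (separatedPrefixes k (q + 1)).filterMap Sum.getRight? :=
    List.mem_filterMap.2 ⟨_, h, rfl⟩
  rw [filterMap_getRight?_separatedPrefixes, List.mem_range'_1] at this
  omega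

theorem infix_of_infix_append_cons {α : Type} {v A B : List α} {a : α} (ha : a ∉ v)
    (h : v <:+: A ++ a :: B) : v <:+: A ∨ v <:+: B := by
  obtain ⟨s, t, h⟩ := h
  rw [List.append_assoc, List.append_eq_append_iff] at h
  rcases h with ⟨c, rfl, hc⟩ | ⟨c, rfl, hc⟩
  · rw [List.append_eq_append_iff] at hc
    rcases hc with ⟨d, rfl, -⟩ | ⟨d, rfl, hd⟩
    · exact Or.inl ⟨s, d, by simp⟩
    · cases d with
      | nil => exact Or.inl ⟨s, [], by simp⟩
      | cons x d =>
        rw [List.cons_append, List.cons.injEq] at hd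
        exact absurd (by simp [hd.1]) ha
  · cases c with
    | nil =>
      cases v with
      | nil => exact Or.inl List.nil_infix
      | cons x v =>
        rw [List.nil_append, List.cons_append, List.cons.injEq] at hc
        exact absurd (by simp [hc.1]) ha
    | cons x c =>
      rw [List.cons_append, List.cons.injEq] at hc
      exact Or.inr ⟨c, t, by simp [hc.2]⟩

/-- A factor without separators of `separatedPrefixes k (q + 1)` lies inside one of the prefixes of
the Thue–Morse word. -/
theorem exists_infix_tmPrefix (k : ℕ → ℕ) (q : ℕ) (v : List (Bool ⊕ ℕ))
    (hv : ∀ i, Sum.inr i ∉ v) (h : v <:+: separatedPrefixes k (q + 1)) :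
    ∃ j, v <:+: tmPrefix j := by
  induction q with
  | zero => exact ⟨_, separatedPrefixes_one k ▸ h⟩
  | succ q ih =>
    rw [separatedPrefixes_succ] at h
    exact (infix_of_infix_append_cons (hv _) h).elim ih fun h => ⟨_, h⟩

theorem cubeFree_separatedPrefixes (k : ℕ → ℕ) (q : ℕ) :
    CubeFree (separatedPrefixes k (q + 1)) := by
  intro u hu h
  by_cases hs : ∃ i, Sum.inr i ∈ u
  · obtain ⟨i, hi⟩ := hs
    have h₁ := h.sublist.filterMap (Sum.getRight? (α := Bool))
    rw [filterMap_getRight?_separatedPrefixes, List.filterMap_append, List.filterMap_append] at h₁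
    have h₂ := (h₁.nodup List.nodup_range').of_append_left
    have h₃ : i ∈ u.filterMap Sum.getRight? := List.mem_filterMap.2 ⟨_, hi, rfl⟩
    exact List.disjoint_of_nodup_append h₂ h₃ h₃
  · push Not at hs
    obtain ⟨j, hj⟩ := exists_infix_tmPrefix k q (u ++ u ++ u) (by simpa using hs) h
    exact cubeFree_tmPrefix j u hu hj

/-- The string determines the lengths of the prefixes. -/
theorem separatedPrefixes_injective {k k' : ℕ → ℕ} {q : ℕ}
    (h : separatedPrefixes k (q + 1) = separatedPrefixes k' (q + 1)) {i : ℕ} (hi : 1 ≤ i)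
    (hq : i ≤ q + 1) : k i = k' i := by
  induction q with
  | zero =>
    obtain rfl : i = 1 := by omega
    simpa [separatedPrefixes_one] using congrArg List.length h
  | succ q ih =>
    rw [separatedPrefixes_succ, separatedPrefixes_succ] at h
    have hn : Sum.inr (q + 1) ∉ separatedPrefixes k (q + 1) := fun hm =>
      lt_irrefl _ (lt_of_inr_mem_separatedPrefixes k q _ hm)
    obtain ⟨h₁, -, h₂⟩ :=
      (List.append_cons_inj_of_notMem hn (inr_notMem_tmPrefix _ _)).1 h
    rcases Nat.lt_or_ge i (q + 2) with hlt | hge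
    · exact ih h₁ (by omega)
    · obtain rfl : i = q + 2 := by omega
      simpa using congrArg List.length h₂

/-! ### LZ-like encodings with few phrases -/

/-- Copying raises heights by at most one, so the height never exceeds the number of phrases. -/
theorem le_length_of_mem_heights {α : Type} (E : List (LZPhrase α)) {x : ℕ}
    (hx : x ∈ heights E) : x ≤ E.length := by
  have key : ∀ (E : List (LZPhrase α)) (H : List ℕ) (h : ℕ), (∀ y ∈ H, y ≤ h) →
      ∀ y ∈ E.foldl appendHeights H, y ≤ h + E.length := by
    intro E
    induction E with
    | nil => exact fun H h hH => hH
    | cons e E ih =>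
      intro H h hH y hy
      have hstep : ∀ z ∈ appendHeights H e, z ≤ h + 1 := by
        intro z hz
        cases e with
        | literal a =>
          rw [appendHeights, List.mem_append, List.mem_singleton] at hz
          rcases hz with hz | rfl
          · exact (hH z hz).trans (Nat.le_succ h)
          · exact Nat.zero_le _
        | copy len src =>
          rw [appendHeights, List.mem_append, List.mem_map] at hz
          rcases hz with hz | ⟨r, -, rfl⟩
          · exact (hH z hz).trans (Nat.le_succ h)
          · refine Nat.succ_le_succ ?_
            rw [List.getD_eq_getElem?_getD]
            cases hr : H[src + r % (H.length - src)]? with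
            | none => exact Nat.zero_le _
            | some v => exact hH v (List.mem_of_getElem? hr)
      have := ih _ _ hstep y hy
      rw [List.length_cons]
      omega
  simpa using key E [] 0 (by simp) x hx

/-- The phrases `E` encode the first `n` symbols of `w`. -/
def EncodesPrefix {α : Type} (w : List α) (E : List (LZPhrase α)) (n : ℕ) : Prop :=
  (E.map LZPhrase.length).sum = n ∧
    ∀ (j : ℕ) (hj : j < E.length), (E[j]).ValidAt w (phraseStart E j)

theorem EncodesPrefix.append {α : Type} {w : List α} {E : List (LZPhrase α)} {n : ℕ}
    (h : EncodesPrefix w E n) {x : LZPhrase α} (hx : x.ValidAt w n) :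
    EncodesPrefix w (E ++ [x]) (n + x.length) := by
  refine ⟨by simp [h.1], fun j hj => ?_⟩
  rw [List.length_append, List.length_singleton] at hj
  rcases Nat.lt_or_ge j E.length with hlt | hge
  · rw [List.getElem_append_left hlt, phraseStart, List.take_append_of_le_length hlt.le]
    exact h.2 j hlt
  · obtain rfl : j = E.length := by omega
    simpa [phraseStart, h.1] using hx

theorem encodesPrefix_nil {α : Type} (w : List α) : EncodesPrefix w [] 0 :=
  ⟨rfl, by simp⟩

/-- If `w` starts with the first `2 ^ (j + 2)` symbols of the Thue–Morse word, these symbols have an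
encoding by `2 * j + 4` phrases: writing `t` for the first `2 ^ (j + 1)` symbols and `t'` for their
complement, the block of `2 ^ (j + 3)` symbols is `t t' t' t`, so that two copies double the
encoded length. -/
theorem exists_encodesPrefix_thueMorse (w : List (Bool ⊕ ℕ)) (j : ℕ)
    (hw : ∀ r < 2 ^ (j + 2), w[r]? = some (Sum.inl (thueMorse r))) :
    ∃ E, EncodesPrefix w E (2 ^ (j + 2)) ∧ E.length = 2 * j + 4 := by
  induction j with
  | zero =>
    have h₀ := encodesPrefix_nil w
    have h₁ := h₀.append (x := .literal _) (hw 0 (by norm_num))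
    have h₂ := h₁.append (x := .literal _) (hw 1 (by norm_num))
    have h₃ := h₂.append (x := .literal _) (hw 2 (by norm_num))
    have h₄ := h₃.append (x := .literal _) (hw 3 (by norm_num))
    exact ⟨_, h₄, rfl⟩
  | succ j ih =>
    have hp : 2 ^ (j + 1 + 2) = 4 * 2 ^ (j + 1) := by ring
    have hp' : 2 ^ (j + 2) = 2 * 2 ^ (j + 1) := by ring
    have hpos : 2 ≤ 2 ^ (j + 1) := by
      rw [pow_succ]
      have := Nat.one_le_two_pow (n := j)
      omega
    obtain ⟨E, hE, hlen⟩ := ih fun r hr => hw r (by omega)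
    have t₁ : ∀ n r, r < 2 ^ n → thueMorse (2 ^ n + r) = !thueMorse r := by
      intro n
      induction n with
      | zero =>
        intro r hr
        obtain rfl : r = 0 := by simpa using hr
        exact thueMorse_two_mul_add_one 0
      | succ n ihn =>
        intro r hr
        rw [pow_succ] at hr
        obtain ⟨a, rfl | rfl⟩ := Nat.even_or_odd' r
        · rw [show 2 ^ (n + 1) + 2 * a = 2 * (2 ^ n + a) by ring, thueMorse_two_mul,
            thueMorse_two_mul, ihn a (by omega)]
        · rw [show 2 ^ (n + 1) + (2 * a + 1) = 2 * (2 ^ n + a) + 1 by ring,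
            thueMorse_two_mul_add_one, thueMorse_two_mul_add_one, ihn a (by omega)]
    have v₁ : (LZPhrase.copy (2 ^ (j + 1)) (2 ^ (j + 1)) : LZPhrase (Bool ⊕ ℕ)).ValidAt w
        (2 ^ (j + 2)) := by
      refine ⟨hpos, by omega, fun r hr => ?_⟩
      rw [hw _ (by omega), hw _ (by omega), t₁ _ r hr, t₁ _ r (by omega)]
    have h₁ := hE.append v₁
    have v₂ : (LZPhrase.copy (2 ^ (j + 1)) 0 : LZPhrase (Bool ⊕ ℕ)).ValidAt w
        (2 ^ (j + 2) + 2 ^ (j + 1)) := by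
      refine ⟨hpos, by omega, fun r hr => ?_⟩
      rw [hw _ (by omega), hw _ (by omega), Nat.zero_add, Nat.add_assoc,
        t₁ (j + 2) _ (by omega), t₁ (j + 1) _ hr, Bool.not_not]
    have h₂ := h₁.append v₂
    have hsum : 2 ^ (j + 2) + 2 ^ (j + 1) + 2 ^ (j + 1) = 2 ^ (j + 1 + 2) := by omega
    simp only [LZPhrase.length, hsum] at h₂
    exact ⟨_, h₂, by simp only [List.length_append, List.length_singleton, hlen]; ring⟩

/-- Every further segment of `separatedPrefixes k (q + 1)` costs two phrases: the separator, and a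
copy of a prefix of the string. -/
theorem exists_encodesPrefix_separatedPrefixes (w : List (Bool ⊕ ℕ)) (k : ℕ → ℕ) (j q : ℕ)
    (hk : k 1 = 2 ^ (j + 2)) (hk' : ∀ i, 1 ≤ i → i ≤ q + 1 → 1 ≤ k i ∧ k i ≤ k 1)
    (hw : separatedPrefixes k (q + 1) <+: w) :
    ∃ E, EncodesPrefix w E (separatedPrefixes k (q + 1)).length ∧
      E.length = 2 * j + 4 + 2 * q ∧
      ∀ r < k 1, w[r]? = some (Sum.inl (thueMorse r)) := by
  induction q with
  | zero =>
    have hw' : ∀ r < k 1, w[r]? = some (Sum.inl (thueMorse r)) := by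
      intro r hr
      obtain ⟨t, rfl⟩ := hw
      rw [separatedPrefixes_one, List.getElem?_append_left (by simpa using hr),
        tmPrefix_getElem? hr]
    obtain ⟨E, hE, hlen⟩ := exists_encodesPrefix_thueMorse w j (hk ▸ hw')
    exact ⟨E, by rwa [separatedPrefixes_one, length_tmPrefix, hk], hlen, hw'⟩
  | succ q ih =>
    rw [separatedPrefixes_succ] at hw ⊢
    obtain ⟨E, hE, hlen, hpre⟩ := ih (fun i h₁ h₂ => hk' i h₁ (by omega))
      ((List.prefix_append _ _).trans hw)
    obtain ⟨hpos, hle⟩ := hk' (q + 2) (by omega) le_rfl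
    obtain ⟨t, rfl⟩ := hw
    set A := separatedPrefixes k (q + 1)
    have h₁ := hE.append (x := .literal (Sum.inr (q + 1)))
      (by simp [LZPhrase.ValidAt])
    have hseg : ∀ r < k (q + 2), (A ++ Sum.inr (q + 1) :: tmPrefix (k (q + 2)) ++ t)[
        A.length + 1 + r]? = some (Sum.inl (thueMorse r)) := by
      intro r hr
      rw [List.append_assoc, List.getElem?_append_right (by omega),
        show A.length + 1 + r - A.length = r + 1 by omega, List.cons_append,
        List.getElem?_cons_succ, List.getElem?_append_left (by simpa using hr),
        tmPrefix_getElem? hr]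
    obtain ⟨x, hx, hxl⟩ : ∃ x : LZPhrase (Bool ⊕ ℕ),
        x.ValidAt (A ++ Sum.inr (q + 1) :: tmPrefix (k (q + 2)) ++ t) (A.length + 1) ∧
          x.length = k (q + 2) := by
      -- A copy has length at least `2`; a segment of length `1` is a literal.
      rcases Nat.eq_or_lt_of_le hpos with h | h
      · exact ⟨.literal (Sum.inl (thueMorse 0)), hseg 0 (by omega), h⟩
      · refine ⟨.copy (k (q + 2)) 0, ⟨h, by omega, fun r hr => ?_⟩, rfl⟩
        rw [hseg r hr, Nat.zero_add, hpre r (by omega)]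
    have h₂ := h₁.append (x := x) hx
    have hsum : A.length + 1 + x.length =
        (A ++ Sum.inr (q + 1) :: tmPrefix (k (q + 2))).length := by
      simp only [List.length_append, List.length_cons, length_tmPrefix, hxl]
      ring
    rw [LZPhrase.length, hsum] at h₂
    exact ⟨_, h₂, by simp only [List.length_append, List.length_singleton, hlen]; ring, hpre⟩

/-- The encoding of the whole string by linearly many phrases in the number of segments and in the
logarithm of `k 1`. -/
theorem exists_isLZEncoding_separatedPrefixes (k : ℕ → ℕ) (j q : ℕ)
    (hk : k 1 = 2 ^ (j + 2)) (hk' : ∀ i, 1 ≤ i → i ≤ q + 1 → 1 ≤ k i ∧ k i ≤ k 1) :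
    ∃ E, IsLZEncoding E (separatedPrefixes k (q + 1)) ∧ E.length = 2 * j + 4 + 2 * q := by
  obtain ⟨E, hE, hlen, -⟩ :=
    exists_encodesPrefix_separatedPrefixes _ k j q hk hk' (List.prefix_refl _)
  exact ⟨E, hE, hlen⟩

/-! ### The greedy parsing is the smallest -/

theorem lz77SizeFrom_of_lt {α : Type} {w : List α} {b : ℕ} (hb : b < w.length) :
    lz77SizeFrom w b = lz77SizeFrom w (b + lz77PhraseLength w b) + 1 := by
  rw [lz77SizeFrom, dif_pos hb]

theorem lz77SizeFrom_of_le {α : Type} {w : List α} {b : ℕ} (hb : w.length ≤ b) :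
    lz77SizeFrom w b = 0 := by
  rw [lz77SizeFrom, dif_neg (by omega)]

theorem phraseStart_succ {α : Type} (E : List (LZPhrase α)) {j : ℕ} (hj : j < E.length) :
    phraseStart E (j + 1) = phraseStart E j + (E[j]).length := by
  rw [phraseStart, List.take_succ_eq_append_getElem hj, List.map_append, List.sum_append,
    List.map_singleton, List.sum_singleton, phraseStart]

theorem phraseStart_le {α : Type} {E : List (LZPhrase α)} {w : List α}
    (hE : IsLZEncoding E w) (j : ℕ) : phraseStart E j ≤ w.length := by
  rw [← hE.1, phraseStart]
  exact ((List.take_sublist j E).map _).sum_le_sum (by simp)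

/-- A suffix of a phrase can be a phrase; hence the greedy phrase that starts inside the `j`-th
phrase of an encoding reaches at least the end of that phrase. -/
theorem phraseStart_succ_le_add_lz77PhraseLength {α : Type} {E : List (LZPhrase α)} {w : List α}
    (hE : IsLZEncoding E w) {j b : ℕ} (hj : j < E.length) (h₁ : phraseStart E j ≤ b)
    (h₂ : b < phraseStart E (j + 1)) :
    phraseStart E (j + 1) ≤ b + lz77PhraseLength w b := by
  have hend := phraseStart_le hE (j + 1)
  have hv := hE.2 j hj
  have hs := phraseStart_succ E hj
  suffices h : CanBePhrase w b (phraseStart E (j + 1) - b) by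
    have : phraseStart E (j + 1) - b ≤ lz77PhraseLength w b :=
      le_csSup ⟨w.length, fun _ h => le_trans (Nat.le_add_left _ _) h.1⟩ h
    omega
  refine ⟨by omega, ?_⟩
  rcases Nat.eq_or_lt_of_le (show 1 ≤ phraseStart E (j + 1) - b by omega) with h | h
  · exact Or.inl h.symm
  · refine Or.inr ⟨h, ?_⟩
    cases hx : E[j] with
    | literal a =>
      rw [hx, LZPhrase.length] at hs
      omega
    | copy len src =>
      rw [hx] at hv hs
      obtain ⟨-, hsrc, hsame⟩ := hv
      rw [LZPhrase.length] at hs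
      refine ⟨src + (b - phraseStart E j), by omega, fun r hr => ?_⟩
      have := hsame (b - phraseStart E j + r) (by omega)
      rw [← Nat.add_assoc, ← Nat.add_assoc] at this
      rwa [show phraseStart E j + (b - phraseStart E j) = b by omega] at this

theorem lz77Size_le {α : Type} {E : List (LZPhrase α)} {w : List α} (hE : IsLZEncoding E w) :
    lz77Size w ≤ E.length := by
  have key : ∀ i j b : ℕ, i + j = E.length → phraseStart E j ≤ b → lz77SizeFrom w b ≤ i := by
    intro i
    induction i with
    | zero =>
      intro j b hj hb
      rw [phraseStart, List.take_of_length_le (by omega), hE.1] at hb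
      exact (lz77SizeFrom_of_le hb).le
    | succ i ih =>
      intro j b hj hb
      rcases Nat.lt_or_ge b w.length with hlt | hge
      · rcases Nat.lt_or_ge b (phraseStart E (j + 1)) with h | h
        · rw [lz77SizeFrom_of_lt hlt]
          exact Nat.succ_le_succ (ih (j + 1) _ (by omega)
            (phraseStart_succ_le_add_lz77PhraseLength hE (by omega) hb h))
        · exact (ih (j + 1) b (by omega) h).trans (Nat.le_succ i)
      · exact (lz77SizeFrom_of_le hge).le.trans (Nat.zero_le _)
  exact key E.length 0 0 rfl le_rfl

theorem zHB_le {α : Type} {E : List (LZPhrase α)} {w : List α} (hE : IsLZEncoding E w) {h : ℝ}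
    (hh : (E.length : ℝ) ≤ h) : zHB w h ≤ E.length :=
  Nat.sInf_le ⟨E, hE, fun _ hx => (Nat.cast_le.2 (le_length_of_mem_heights E hx)).trans hh, rfl⟩

/-! ### Iteration rules that generate cube-free strings -/

theorem infix_flatMap_of_mem {α β : Type} {l : List α} {a : α} (h : a ∈ l) (f : α → List β) :
    f a <:+: l.flatMap f := by
  obtain ⟨s, t, rfl⟩ := List.append_of_mem h
  exact ⟨s.flatMap f, t.flatMap f, by simp⟩

theorem CubeFree.le_two_of_replicate {α : Type} {u : List α} {n : ℕ}
    (h : CubeFree (List.replicate n u).flatten) (hu : u ≠ []) : n ≤ 2 := by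
  by_contra hn
  obtain ⟨m, rfl⟩ := Nat.exists_eq_add_of_le' (show 3 ≤ n by omega)
  exact h u hu ⟨[], (List.replicate m u).flatten, by simp [List.replicate_succ]⟩

theorem mem_iterRange {k₁ k₂ i : ℕ} : i ∈ iterRange k₁ k₂ ↔ min k₁ k₂ ≤ i ∧ i ≤ max k₁ k₂ := by
  unfold iterRange
  split
  · rw [List.mem_range'_1]
    omega
  · rw [List.mem_reverse, List.mem_range'_1]
    omega

theorem length_iterRange (k₁ k₂ : ℕ) :
    (iterRange k₁ k₂).length = max k₁ k₂ - min k₁ k₂ + 1 := by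
  unfold iterRange
  split
  · rw [List.length_range']
    omega
  · rw [List.length_reverse, List.length_range']
    omega

theorem flatMap_replicate_eq {α β : Type} (n : ℕ) (a : α) (f : α → List β) :
    (List.replicate n a).flatMap f = (List.replicate n (f a)).flatten := by
  rw [List.flatMap_def, List.map_replicate]

/-- In an iteration rule that generates a cube-free string, every power has exponent at most `2`,
and there are at most two rounds: a third round would have an index at least `3`, so that all
`c_j` vanish and the rounds are equal. -/
theorem iter_bounds {α : Type} {X : List (List α)} (hX : ∀ x ∈ X, x ≠ []) {d k₁ k₂ : ℕ}
    {body : List (ℕ × ℕ)} (hR : (ItRule.iter k₁ k₂ body : ItRule α).Valid d X.length)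
    (hc : CubeFree ((ItRule.iter k₁ k₂ body).expand X)) :
    (∀ i ∈ iterRange k₁ k₂, ∀ q ∈ body, i ^ q.2 ≤ 2) ∧ (iterRange k₁ k₂).length ≤ 2 := by
  obtain ⟨h₁, h₂, hb, hq⟩ := hR
  rw [ItRule.expand] at hc
  have hne : ∀ q ∈ body, X.getD q.1 [] ≠ [] := by
    intro q hqb
    rw [List.getD_eq_getElem _ _ (hq q hqb).1]
    exact hX _ (List.getElem_mem _)
  have hpow : ∀ i ∈ iterRange k₁ k₂, ∀ q ∈ body, i ^ q.2 ≤ 2 := by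
    intro i hi q hqb
    refine CubeFree.le_two_of_replicate ?_ (hne q hqb)
    exact (hc.of_infix (infix_flatMap_of_mem hi _)).of_infix
      (infix_flatMap_of_mem hqb fun q => (List.replicate (i ^ q.2) (X.getD q.1 [])).flatten)
  refine ⟨hpow, ?_⟩
  by_contra hlen
  have hl := length_iterRange k₁ k₂
  have hexp : ∀ q ∈ body, q.2 = 0 := by
    intro q hqb
    by_contra h
    have h₃ := hpow _ (mem_iterRange.2 ⟨min_le_max, le_rfl⟩) q hqb
    have h₄ := Nat.le_self_pow h (max k₁ k₂)
    omega
  have heq : ((iterRange k₁ k₂).flatMap fun i =>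
      body.flatMap fun q => (List.replicate (i ^ q.2) (X.getD q.1 [])).flatten) =
      (List.replicate (iterRange k₁ k₂).length
        (body.flatMap fun q => X.getD q.1 [])).flatten := by
    rw [← List.map_const', ← List.flatMap_def]
    refine List.flatMap_congr fun i _ => List.flatMap_congr fun q hqb => ?_
    simp [hexp q hqb]
  rw [heq] at hc
  refine hlen (hc.le_two_of_replicate ?_)
  obtain ⟨q, hqb⟩ := List.exists_mem_of_ne_nil _ hb
  intro h
  rw [List.flatMap_eq_nil_iff] at h
  exact hne q hqb (h q hqb)

/-- A rule that generates a cube-free string can be replaced by a plain list of symbols and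
variables, of length linear in the size of the rule. -/
theorem ItRule.exists_flatMap_eq_expand {α : Type} {X : List (List α)} (hX : ∀ x ∈ X, x ≠ [])
    {d : ℕ} {R : ItRule α} (hR : R.Valid d X.length) (hc : CubeFree (R.expand X)) :
    ∃ l : List (α ⊕ ℕ), l.length + 1 ≤ 2 * R.size ∧ (∀ i, Sum.inr i ∈ l → i < X.length) ∧
      l.flatMap (Sum.elim (fun a => [a]) fun i => X.getD i []) = R.expand X := by
  cases R with
  | terminal a => exact ⟨[Sum.inl a], by simp [ItRule.size], by simp, by simp [ItRule.expand]⟩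
  | binary B C =>
    refine ⟨[Sum.inr B, Sum.inr C], by simp [ItRule.size], ?_, by simp [ItRule.expand]⟩
    rintro i hi
    simp only [List.mem_cons, Sum.inr.injEq, List.not_mem_nil, or_false] at hi
    rcases hi with rfl | rfl
    exacts [hR.1, hR.2]
  | iter k₁ k₂ body =>
    obtain ⟨hpow, hlen⟩ := iter_bounds hX hR hc
    refine ⟨((iterRange k₁ k₂).flatMap fun i =>
      body.flatMap fun q => List.replicate (i ^ q.2) q.1).map Sum.inr, ?_, ?_, ?_⟩
    · have hrow : ∀ i ∈ iterRange k₁ k₂,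
          (body.flatMap fun q => List.replicate (i ^ q.2) q.1).length ≤ body.length * 2 := by
        intro i hi
        rw [List.length_flatMap]
        refine (List.sum_le_card_nsmul _ 2 ?_).trans (by simp)
        intro x hx
        obtain ⟨q, hq, rfl⟩ := List.mem_map.1 hx
        exact List.length_replicate.trans_le (hpow i hi q hq)
      have htot : ((iterRange k₁ k₂).flatMap fun i =>
          body.flatMap fun q => List.replicate (i ^ q.2) q.1).length ≤
          (iterRange k₁ k₂).length * (body.length * 2) := by
        rw [List.length_flatMap]
        refine (List.sum_le_card_nsmul _ (body.length * 2) ?_).trans (by simp)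
        intro x hx
        obtain ⟨i, hi, rfl⟩ := List.mem_map.1 hx
        exact hrow i hi
      have := Nat.mul_le_mul_right (body.length * 2) hlen
      rw [List.length_map, ItRule.size]
      omega
    · intro i hi
      simp only [List.mem_map, List.mem_flatMap, List.mem_replicate, Sum.inr.injEq,
        exists_eq_right] at hi
      obtain ⟨_, -, q, hq, -, rfl⟩ := hi
      exact (hR.2.2.2 q hq).1
    · simp only [ItRule.expand, List.flatMap_map, List.flatMap_assoc, Sum.elim_inr,
        flatMap_replicate_eq]

/-! ### Iterated straight-line programs as words over a small alphabet -/

theorem itExpansions_concat {α : Type} (G : List (ItRule α)) (R : ItRule α) :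
    itExpansions (G ++ [R]) = itExpansions G ++ [R.expand (itExpansions G)] := by
  simp [itExpansions]

@[simp]
theorem length_itExpansions {α : Type} (G : List (ItRule α)) :
    (itExpansions G).length = G.length := by
  induction G using List.reverseRecOn with
  | nil => rfl
  | append_singleton G R ih => simp [itExpansions_concat, ih]

theorem forall_getElem_concat {α : Type} {P : ℕ → α → Prop} {G : List α} {R : α} :
    (∀ (j : ℕ) (hj : j < (G ++ [R]).length), P j (G ++ [R])[j]) ↔
      (∀ (j : ℕ) (hj : j < G.length), P j G[j]) ∧ P G.length R := by
  constructor
  · intro h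
    refine ⟨fun j hj => ?_, ?_⟩
    · have := h j (by simp; omega)
      rwa [List.getElem_append_left hj] at this
    · simpa using h G.length (by simp)
  · rintro ⟨h₁, h₂⟩ j hj
    rcases Nat.lt_or_ge j G.length with hlt | hge
    · rw [List.getElem_append_left hlt]
      exact h₁ j hlt
    · obtain rfl : j = G.length := by
        rw [List.length_append, List.length_singleton] at hj
        omega
      simpa using h₂

theorem ItRule.expand_ne_nil {α : Type} {X : List (List α)} (hX : ∀ x ∈ X, x ≠ []) {d : ℕ}
    {R : ItRule α} (hR : R.Valid d X.length) : R.expand X ≠ [] := by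
  have hne : ∀ i < X.length, X.getD i [] ≠ [] := by
    intro i hi
    rw [List.getD_eq_getElem _ _ hi]
    exact hX _ (List.getElem_mem _)
  cases R with
  | terminal a => simp [ItRule.expand]
  | binary B C => exact fun h => hne B hR.1 (List.append_eq_nil_iff.1 h).1
  | iter k₁ k₂ body =>
    obtain ⟨h₁, h₂, hb, hq⟩ := hR
    obtain ⟨q, hqb⟩ := List.exists_mem_of_ne_nil _ hb
    intro h
    rw [ItRule.expand, List.flatMap_eq_nil_iff] at h
    have h := List.flatMap_eq_nil_iff.1 (h k₁ (mem_iterRange.2 (by omega))) q hqb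
    exact hne _ (hq q hqb).1 (List.flatten_eq_nil_iff.1 h _
      (List.mem_replicate.2 ⟨(pow_pos h₁ _).ne', rfl⟩))

theorem itExpansions_ne_nil {α : Type} {d : ℕ} {G : List (ItRule α)}
    (hG : ∀ (j : ℕ) (hj : j < G.length), (G[j]).Valid d j) : ∀ x ∈ itExpansions G, x ≠ [] := by
  induction G using List.reverseRecOn with
  | nil => simp [itExpansions]
  | append_singleton G R ih =>
    obtain ⟨h₁, h₂⟩ := forall_getElem_concat.1 hG
    intro x hx
    rw [itExpansions_concat, List.mem_append, List.mem_singleton] at hx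
    rcases hx with hx | rfl
    · exact ih h₁ x hx
    · exact ItRule.expand_ne_nil (ih h₁) (by simpa using h₂)

/-- One step of the machine that evaluates a straight-line program written as a word over
`Option (A ⊕ Fin B)`. The state consists of the strings of the completed variables and of the
string built so far for the next one: `some (Sum.inl a)` appends the symbol `e a`, the token
`some (Sum.inr i)` appends the string of the variable `i`, and `none` completes the variable. -/
def slpStep {α A : Type} {B : ℕ} (e : A → α) (S : List (List α) × List α) :
    Option (A ⊕ Fin B) → List (List α) × List α
  | none => (S.1 ++ [S.2], [])
  | some (Sum.inl a) => (S.1, S.2 ++ [e a])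
  | some (Sum.inr i) => (S.1, S.2 ++ S.1.getD i [])

/-- The string left in construction when the word `P` has been read. -/
def slpEval {α A : Type} {B : ℕ} (e : A → α) (P : List (Option (A ⊕ Fin B))) : List α :=
  (P.foldl (slpStep e) ([], [])).2

theorem foldl_slpStep_map_some {α A : Type} {B : ℕ} (e : A → α) (l : List (A ⊕ Fin B))
    (Y : List (List α)) (v : List α) :
    (l.map some).foldl (slpStep e) (Y, v) =
      (Y, v ++ (l.map (Sum.map e Fin.val)).flatMap
        (Sum.elim (fun a => [a]) fun i => Y.getD i [])) := by
  induction l generalizing v with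
  | nil => simp
  | cons x l ih =>
    rcases x with a | i
    · simp [slpStep, ih]
    · simp [slpStep, ih]

/-- A valid sequence of rules translates into a word of linear length that computes all those
expansions that are factors of the cube-free string `w`; the other variables, whose rules may involve
large powers or foreign symbols, are replaced by empty strings. -/
theorem exists_foldl_slpStep {α A : Type} {B : ℕ} (e : A → α) {w : List α} (hw : CubeFree w)
    (he : ∀ a ∈ w, a ∈ Set.range e) {d : ℕ} (G : List (ItRule α))
    (hG : ∀ (j : ℕ) (hj : j < G.length), (G[j]).Valid d j) (hB : G.length ≤ B) :
    ∃ (P : List (Option (A ⊕ Fin B))) (Y : List (List α)),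
      P.length ≤ 2 * (G.map ItRule.size).sum ∧ P.foldl (slpStep e) ([], []) = (Y, []) ∧
      Y.length = G.length ∧
      ∀ j, (itExpansions G).getD j [] <:+: w → Y.getD j [] = (itExpansions G).getD j [] := by
  induction G using List.reverseRecOn with
  | nil => exact ⟨[], [], by simp, rfl, rfl, fun j _ => rfl⟩
  | append_singleton G R ih =>
    obtain ⟨hG₁, hR⟩ := forall_getElem_concat.1 hG
    rw [List.length_append, List.length_singleton] at hB
    obtain ⟨P, Y, hP, hPY, hY, hYX⟩ := ih hG₁ (by omega)
    -- It suffices to translate the last rule, when its expansion is a factor of `w`.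
    obtain ⟨l, v, hl, hlv, hv⟩ : ∃ (l : List (A ⊕ Fin B)) (v : List α),
        l.length + 1 ≤ 2 * R.size ∧
        (l.map some).foldl (slpStep e) (Y, []) = (Y, v) ∧
        (R.expand (itExpansions G) <:+: w → v = R.expand (itExpansions G)) := by
      by_cases hin : R.expand (itExpansions G) <:+: w
      · obtain ⟨l, hl, hlN, hlX⟩ := ItRule.exists_flatMap_eq_expand (itExpansions_ne_nil hG₁)
          (by simpa using hR) (hw.of_infix hin)
        have hfac : ∀ x ∈ l,
            Sum.elim (fun a => [a]) (fun i => (itExpansions G).getD i []) x <:+: w :=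
          fun x hx => (hlX ▸ infix_flatMap_of_mem hx _ :
            Sum.elim (fun a => [a]) (fun i => (itExpansions G).getD i []) x <:+:
              R.expand (itExpansions G)).trans hin
        obtain ⟨l, rfl⟩ : l ∈ Set.range (List.map (Sum.map e (Fin.val (n := B)))) := by
          rw [Set.range_list_map]
          rintro (a | i) hx
          · obtain ⟨b, rfl⟩ := he a ((hfac _ hx).subset (by simp))
            exact ⟨Sum.inl b, rfl⟩
          · have := hlN i hx
            rw [length_itExpansions] at this
            exact ⟨Sum.inr ⟨i, by omega⟩, rfl⟩
        refine ⟨l, _, by simpa using hl, foldl_slpStep_map_some e l Y [], fun _ => ?_⟩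
        rw [List.nil_append, ← hlX]
        refine List.flatMap_congr fun x hx => ?_
        rcases x with a | i
        · rfl
        · exact hYX i (hfac _ hx)
      · refine ⟨[], [], ?_, rfl, fun h => absurd h hin⟩
        cases R <;> simp only [ItRule.size, List.length_nil] <;> omega
    refine ⟨P ++ (l.map some ++ [none]), Y ++ [v], ?_, ?_, by simp [hY], fun j => ?_⟩
    · simp only [List.length_append, List.length_map, List.map_append, List.sum_append,
        List.length_singleton, List.map_singleton, List.sum_singleton]
      omega
    · rw [List.foldl_append, hPY, List.foldl_append, hlv]
      rfl
    · rw [itExpansions_concat]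
      rcases lt_trichotomy j G.length with h | rfl | h
      · rw [List.getD_append _ _ _ _ (by simpa using h), List.getD_append _ _ _ _ (by omega)]
        exact hYX j
      · rw [List.getD_append_right _ _ _ _ (by simp), List.getD_append_right _ _ _ _ (by omega)]
        simpa [hY] using hv
      · rw [List.getD_eq_default _ _ (by simp; omega), List.getD_eq_default _ _ (by simp; omega)]
        exact fun _ => rfl

theorem length_le_sum_size {α : Type} (G : List (ItRule α)) :
    G.length ≤ (G.map ItRule.size).sum := by
  have := List.card_nsmul_le_sum (G.map ItRule.size) 1 (by
    intro x hx
    obtain ⟨R, -, rfl⟩ := List.mem_map.1 hx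
    cases R <;> simp only [ItRule.size] <;> omega)
  simpa using this

theorem IsISLP.exists_slpEval_eq {α A : Type} (e : A → α) {w : List α} (hw : CubeFree w)
    (he : ∀ a ∈ w, a ∈ Set.range e) {d g : ℕ} {G : List (ItRule α)} (hG : IsISLP d G w)
    (hg : (G.map ItRule.size).sum ≤ g) :
    ∃ P : List (Option (A ⊕ Fin g)), P.length ≤ 2 * g + 1 ∧ slpEval e P = w := by
  have hlen := length_le_sum_size G
  obtain ⟨P, Y, hP, hPY, hY, hYX⟩ := exists_foldl_slpStep (B := g) e hw he G hG.1 (by omega)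
  obtain ⟨j, hj, hjw⟩ := List.getElem_of_mem hG.2
  have hj' : j < G.length := by simpa using hj
  refine ⟨P ++ [some (Sum.inr ⟨j, by omega⟩)], by simp; omega, ?_⟩
  have hX : (itExpansions G).getD j [] = w := by rw [List.getD_eq_getElem _ _ hj, hjw]
  have := hYX j (hX ▸ List.infix_refl _)
  rw [slpEval, List.foldl_append, hPY]
  simp only [List.foldl_cons, List.foldl_nil, slpStep, List.nil_append]
  rw [this, hX]

/-- Counting: only few cube-free strings over a finite alphabet `A` have an iterated straight-line
program of size at most `g`, of any degree. -/
theorem card_le_of_isISLP {α A ι : Type} [Fintype A] [Fintype ι] (e : A → α) (word : ι → List α)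
    (hinj : Function.Injective word) (hw : ∀ i, CubeFree (word i))
    (he : ∀ i, ∀ a ∈ word i, a ∈ Set.range e) (g : ℕ)
    (hG : ∀ i, ∃ d G, IsISLP d G (word i) ∧ (G.map ItRule.size).sum ≤ g) :
    Fintype.card ι ≤ (Fintype.card A + g + 2) ^ (2 * g + 1) := by
  have hP : ∀ i, ∃ P : List (Option (A ⊕ Fin g)), P.length ≤ 2 * g + 1 ∧ slpEval e P = word i := by
    intro i
    obtain ⟨d, G, hG, hg⟩ := hG i
    exact hG.exists_slpEval_eq e (hw i) (he i) hg
  choose P hP₁ hP₂ using hP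
  -- The words `P i` are padded to the common length `2 * g + 1`.
  have hinj' : Function.Injective fun i => fun r : Fin (2 * g + 1) => (P i)[(r : ℕ)]? := by
    intro i i' h
    have : P i = P i' := by
      refine List.ext_getElem? fun r => ?_
      rcases Nat.lt_or_ge r (2 * g + 1) with hr | hr
      · exact congrFun h ⟨r, hr⟩
      · rw [List.getElem?_eq_none ((hP₁ i).trans hr), List.getElem?_eq_none ((hP₁ i').trans hr)]
    exact hinj (by rw [← hP₂, ← hP₂, this])
  simpa [Fintype.card_option] using Fintype.card_le_of_injective _ hinj'

/-! ### Run-length straight-line programs -/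

/-- The rule `A → B ^ t` as the iteration rule `A → ∏_{i = 1}^{t} B ^ (i ^ 0)`. -/
def RLRule.toItRule {α : Type} : RLRule α → ItRule α
  | .terminal a => .terminal a
  | .binary B C => .binary B C
  | .run B t => .iter 1 t [(B, 0)]

theorem RLRule.size_toItRule_le {α : Type} (R : RLRule α) : R.toItRule.size ≤ 2 * R.size := by
  cases R <;> simp [RLRule.toItRule, RLRule.size, ItRule.size]

theorem RLRule.Valid.toItRule {α : Type} {N : ℕ} {R : RLRule α} (h : R.Valid N) :
    R.toItRule.Valid 0 N := by
  cases R with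
  | terminal a => trivial
  | binary B C => exact h
  | run B t => exact ⟨le_rfl, by have := h.2; omega, by simp, by simpa using h.1⟩

theorem RLRule.Valid.expand_toItRule {α : Type} {N : ℕ} {R : RLRule α} (h : R.Valid N)
    (X : List (List α)) : R.toItRule.expand X = R.expand X := by
  cases R with
  | terminal a => rfl
  | binary B C => rfl
  | run B t =>
    have ht : 1 ≤ t := by
      have := h.2
      omega
    simp [RLRule.toItRule, ItRule.expand, RLRule.expand, iterRange, ht, List.flatMap_def,
      List.map_const']

theorem rlExpansions_concat {α : Type} (G : List (RLRule α)) (R : RLRule α) :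
    rlExpansions (G ++ [R]) = rlExpansions G ++ [R.expand (rlExpansions G)] := by
  simp [rlExpansions]

@[simp]
theorem length_rlExpansions {α : Type} (G : List (RLRule α)) :
    (rlExpansions G).length = G.length := by
  induction G using List.reverseRecOn with
  | nil => rfl
  | append_singleton G R ih => simp [rlExpansions_concat, ih]

theorem itExpansions_map_toItRule {α : Type} {G : List (RLRule α)}
    (hG : ∀ (j : ℕ) (hj : j < G.length), (G[j]).Valid j) :
    itExpansions (G.map RLRule.toItRule) = rlExpansions G := by
  induction G using List.reverseRecOn with
  | nil => rfl
  | append_singleton G R ih =>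
    obtain ⟨h₁, h₂⟩ := forall_getElem_concat.1 hG
    rw [List.map_append, List.map_singleton, itExpansions_concat, rlExpansions_concat, ih h₁,
      h₂.expand_toItRule]

theorem IsRLSLP.isISLP {α : Type} {G : List (RLRule α)} {w : List α} (h : IsRLSLP G w) :
    IsISLP 0 (G.map RLRule.toItRule) w := by
  refine ⟨fun j hj => ?_, itExpansions_map_toItRule h.1 ▸ h.2⟩
  rw [List.getElem_map]
  exact (h.1 j (by simpa using hj)).toItRule

theorem sum_size_map_toItRule_le {α : Type} (G : List (RLRule α)) :
    ((G.map RLRule.toItRule).map ItRule.size).sum ≤ 2 * (G.map RLRule.size).sum := by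
  induction G with
  | nil => simp
  | cons R G ih =>
    have := R.size_toItRule_le
    simp only [List.map_cons, List.sum_cons]
    omega

theorem exists_isRLSLP {α : Type} {w : List α} (hw : w ≠ []) : ∃ G, IsRLSLP G w := by
  induction w using List.reverseRecOn with
  | nil => exact absurd rfl hw
  | append_singleton w a ih =>
    rcases eq_or_ne w [] with rfl | hne
    · refine ⟨[.terminal a], fun j hj => ?_, by simp [rlExpansions, RLRule.expand]⟩
      obtain rfl : j = 0 := by simpa using hj
      trivial
    · obtain ⟨G, hG, hmem⟩ := ih hne
      obtain ⟨j, hj, hjw⟩ := List.getElem_of_mem hmem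
      refine ⟨G ++ [.terminal a] ++ [.binary j G.length], ?_, ?_⟩
      · refine forall_getElem_concat.2 ⟨forall_getElem_concat.2 ⟨hG, trivial⟩, ?_⟩
        rw [length_rlExpansions] at hj
        simp only [RLRule.Valid, List.length_append, List.length_singleton]
        omega
      · rw [rlExpansions_concat, rlExpansions_concat]
        refine List.mem_append_right _ (List.mem_singleton.2 ?_)
        simp only [RLRule.expand]
        rw [List.getD_append _ _ _ _ hj, List.getD_eq_getElem _ _ hj, hjw,
          List.getD_append_right _ _ _ _ (by simp)]
        simp

theorem le_two_mul_gRL {α : Type} {w : List α} (hw : w ≠ []) {g : ℕ}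
    (h : ∀ G, IsISLP 0 G w → g ≤ (G.map ItRule.size).sum) : g ≤ 2 * gRL w := by
  obtain ⟨G₀, hG₀⟩ := exists_isRLSLP hw
  obtain ⟨G, hG, hsize⟩ := Nat.sInf_mem
    (s := {g : ℕ | ∃ G : List (RLRule α), IsRLSLP G w ∧ (G.map RLRule.size).sum = g})
    ⟨_, G₀, hG₀, rfl⟩
  rw [gRL, ← hsize]
  exact (h _ hG.isISLP).trans (sum_size_map_toItRule_le G)

theorem IsISLP.mono {α : Type} {d d' : ℕ} (hd : d ≤ d') {G : List (ItRule α)} {w : List α}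
    (h : IsISLP d G w) : IsISLP d' G w := by
  refine ⟨fun j hj => ?_, h.2⟩
  have := h.1 j hj
  cases hR : G[j] with
  | terminal a => trivial
  | binary B C => rwa [hR] at this
  | iter k₁ k₂ body =>
    rw [hR] at this
    exact ⟨this.1, this.2.1, this.2.2.1, fun q hq =>
      ⟨(this.2.2.2 q hq).1, (this.2.2.2 q hq).2.trans hd⟩⟩

theorem le_gIt {α : Type} {w : List α} (hw : w ≠ []) {g d : ℕ}
    (h : ∀ G, IsISLP d G w → g ≤ (G.map ItRule.size).sum) : g ≤ gIt d w := by
  obtain ⟨G₀, hG₀⟩ := exists_isRLSLP hw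
  obtain ⟨G, hG, hsize⟩ := Nat.sInf_mem
    (s := {g : ℕ | ∃ G : List (ItRule α), IsISLP d G w ∧ (G.map ItRule.size).sum = g})
    ⟨_, _, hG₀.isISLP.mono (Nat.zero_le d), rfl⟩
  rw [gIt, ← hsize]
  exact h _ hG

/-! ### Segment lengths without small grammars -/

theorem pow_lt_two_pow_sq {L : ℕ} (hL : 64 ≤ L) :
    (L + 3 + L ^ 2 / (16 * (Nat.log 2 L + 1)) + 2) ^ (2 * (L ^ 2 / (16 * (Nat.log 2 L + 1))) + 1) <
      2 ^ (L * L) := by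
  set b := Nat.log 2 L + 1 with hb
  set g := L ^ 2 / (16 * b) with hg
  have hg₁ : 16 * b * g ≤ L ^ 2 := Nat.mul_div_le _ _
  have hLb : L < 2 ^ b := Nat.lt_pow_succ_log_self (by norm_num) L
  have hbL : b ≤ L := Nat.log_lt_self 2 (by omega)
  have hb₁ : 1 ≤ b := by omega
  have hgL : L + 3 + g + 2 ≤ L ^ 2 := by
    have : g ≤ b * g := Nat.le_mul_of_pos_left g hb₁
    nlinarith
  have hbase : L + 3 + g + 2 ≤ 2 ^ (2 * b) := by
    rw [Nat.mul_comm, pow_mul]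
    exact hgL.trans (Nat.pow_le_pow_left hLb.le 2)
  calc (L + 3 + g + 2) ^ (2 * g + 1) ≤ (2 ^ (2 * b)) ^ (2 * g + 1) := Nat.pow_le_pow_left hbase _
    _ = 2 ^ (2 * b * (2 * g + 1)) := (pow_mul _ _ _).symm
    _ < 2 ^ (L * L) := Nat.pow_lt_pow_right (by norm_num) (by nlinarith)

/-- The segment lengths that start with `2 ^ L` and continue with the values of `f`, shifted by
one to be positive. -/
def segmentLengths (L : ℕ) (f : Fin L → Fin (2 ^ L)) (i : ℕ) : ℕ :=
  if h : 2 ≤ i ∧ i - 2 < L then f ⟨i - 2, h.2⟩ + 1 else 2 ^ L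

theorem segmentLengths_one (L : ℕ) (f : Fin L → Fin (2 ^ L)) : segmentLengths L f 1 = 2 ^ L := by
  simp [segmentLengths]

theorem segmentLengths_bounds (L : ℕ) (f : Fin L → Fin (2 ^ L)) (i : ℕ) :
    1 ≤ segmentLengths L f i ∧ segmentLengths L f i ≤ 2 ^ L := by
  unfold segmentLengths
  split
  · exact ⟨Nat.le_add_left _ _, (f _).2⟩
  · exact ⟨Nat.one_le_two_pow, le_rfl⟩

/-- There are `2 ^ (L * L)` choices of the segment lengths, more than there are strings with small
grammars. -/
theorem exists_segmentLengths {L : ℕ} (hL : 64 ≤ L) :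
    ∃ f : Fin L → Fin (2 ^ L), ∀ d G,
      IsISLP d G (separatedPrefixes (segmentLengths L f) (L + 1)) →
        L ^ 2 / (16 * (Nat.log 2 L + 1)) + 1 ≤ (G.map ItRule.size).sum := by
  by_contra! hcon
  have hinj : Function.Injective fun f : Fin L → Fin (2 ^ L) =>
      separatedPrefixes (segmentLengths L f) (L + 1) := by
    intro f f' h
    funext i
    have := separatedPrefixes_injective h (i := i + 2) (by omega) (by omega)
    simpa [segmentLengths, Fin.ext_iff] using this
  have hcard := card_le_of_isISLP (A := Bool ⊕ Fin (L + 1)) (Sum.map id Fin.val) _ hinj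
    (fun f => cubeFree_separatedPrefixes _ L) ?_ (L ^ 2 / (16 * (Nat.log 2 L + 1))) ?_
  · refine absurd (pow_lt_two_pow_sq hL) (not_lt.2 ?_)
    simp only [Fintype.card_fun, Fintype.card_fin, Fintype.card_sum, Fintype.card_bool,
      ← pow_mul] at hcard
    refine hcard.trans_eq ?_
    congr 2
    ring
  · rintro f (a | i) hi
    · exact ⟨Sum.inl a, rfl⟩
    · exact ⟨Sum.inr ⟨i, lt_of_inr_mem_separatedPrefixes _ L i hi⟩, rfl⟩
  · intro f
    obtain ⟨d, G, hG, hlt⟩ := hcon f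
    exact ⟨d, G, hG, Nat.lt_succ_iff.1 hlt⟩

theorem div_logb_le {L : ℕ} (hL : 64 ≤ L) :
    1 / 32 * ((L : ℝ) ^ 2 / Real.logb 2 L) ≤ ((L ^ 2 / (16 * (Nat.log 2 L + 1)) + 1 : ℕ) : ℝ) := by
  have hlog : (Nat.log 2 L : ℝ) ≤ Real.logb 2 L := by
    have := Real.natLog_le_logb L 2
    exact_mod_cast this
  have hlog₁ : (1 : ℝ) ≤ Nat.log 2 L := by
    exact_mod_cast Nat.log_pos (by norm_num) (by omega)
  have hpos : (0 : ℝ) < 16 * (Nat.log 2 L + 1) := by positivity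
  have h₁ : 1 / 32 * ((L : ℝ) ^ 2 / Real.logb 2 L) ≤ (L : ℝ) ^ 2 / (16 * (Nat.log 2 L + 1)) := by
    rw [one_div, inv_mul_eq_div, div_div]
    exact div_le_div_of_nonneg_left (by positivity) hpos (by linarith)
  refine h₁.trans ?_
  rw [div_le_iff₀ hpos]
  have := (Nat.lt_mul_div_succ (L ^ 2) (show 0 < 16 * (Nat.log 2 L + 1) by omega)).le
  rw [mul_comm]
  exact_mod_cast this

/-! ### Asymptotics -/

theorem isLittleO_id_sq_div_logb :
    (fun x : ℝ => x) =o[atTop] fun x : ℝ => x ^ 2 / Real.logb 2 x := by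
  have h : (fun x : ℝ => Real.logb 2 x) =o[atTop] fun x : ℝ => x := by
    simp only [Real.logb, div_eq_inv_mul]
    exact Real.isLittleO_log_id_atTop.const_mul_left _
  have h' := h.mul_isBigO (isBigO_refl (fun x : ℝ => x * (Real.logb 2 x)⁻¹) atTop)
  refine h'.congr' ?_ ?_
  · filter_upwards [eventually_gt_atTop 1] with x hx
    have := (Real.logb_pos one_lt_two hx).ne'
    field_simp
  · filter_upwards with x
    ring

/-- A lower bound of order `L² / log L` with `L = m + 2` dominates an upper bound of order `L`. -/
theorem isLittleO_of_le_of_ge {u v : ℕ → ℝ} {C : ℝ} (hC : 0 < C)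
    (hu : u =O[atTop] fun m : ℕ => ((m + 2 : ℕ) : ℝ))
    (hv : ∀ᶠ m : ℕ in atTop,
      C * (((m + 2 : ℕ) : ℝ) ^ 2 / Real.logb 2 ((m + 2 : ℕ) : ℝ)) ≤ v m) : u =o[atTop] v := by
  have htend : Tendsto (fun m : ℕ => ((m + 2 : ℕ) : ℝ)) atTop atTop :=
    tendsto_natCast_atTop_atTop.comp (tendsto_add_atTop_nat 2)
  refine (hu.trans_isLittleO (isLittleO_id_sq_div_logb.comp_tendsto htend)).trans_isBigO ?_
  refine IsBigO.of_bound C⁻¹ ?_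
  filter_upwards [hv] with m hm
  have h₀ : 0 ≤ ((m + 2 : ℕ) : ℝ) ^ 2 / Real.logb 2 ((m + 2 : ℕ) : ℝ) :=
    div_nonneg (by positivity)
      (Real.logb_nonneg one_lt_two (by exact_mod_cast Nat.le_add_left 1 (m + 1)))
  rw [Function.comp_apply, Real.norm_of_nonneg h₀, inv_mul_eq_div, le_div_iff₀ hC, mul_comm]
  exact hm.trans (le_abs_self _)

theorem le_length_separatedPrefixes (k : ℕ → ℕ) (p : ℕ) :
    k 1 ≤ (separatedPrefixes k p).length := by
  simp [separatedPrefixes]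

theorem mainTheorem2 :
    ∃ (p : ℕ → ℕ) (k : ℕ → ℕ → ℕ) (s : ℕ → List (Bool ⊕ ℕ)) (c : ℝ),
      -- the shape of the family `s`
      (∀ m, s m = separatedPrefixes (k m) (p m)) ∧
      (∀ m, 1 ≤ p m ∧ ∀ i, 1 ≤ i → i ≤ p m → 1 ≤ k m i ∧ k m i ≤ k m 1) ∧
      Tendsto (fun m => k m 1) atTop atTop ∧
      (fun m => (p m : ℝ)) =Θ[atTop] (fun m => Real.logb 2 (k m 1)) ∧
      0 < c ∧
      -- upper bounds
      (fun m => (lz77Size (s m) : ℝ)) =O[atTop] (fun m => Real.logb 2 (k m 1)) ∧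
      (fun m => (zHB (s m) (c * Real.logb 2 (s m).length) : ℝ))
        =O[atTop] (fun m => Real.logb 2 (k m 1)) ∧
      -- lower bounds
      (∃ C : ℝ, 0 < C ∧ ∀ᶠ m in atTop,
        C * (Real.logb 2 (k m 1) ^ 2 / Real.logb 2 (Real.logb 2 (k m 1))) ≤ (gRL (s m) : ℝ)) ∧
      (∃ C : ℝ, 0 < C ∧ ∀ᶠ m in atTop, ∀ d : ℕ,
        C * (Real.logb 2 (k m 1) ^ 2 / Real.logb 2 (Real.logb 2 (k m 1))) ≤ (gIt d (s m) : ℝ)) ∧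
      -- the separation
      (fun m => (zHB (s m) (c * Real.logb 2 (s m).length) : ℝ))
        =o[atTop] (fun m => (gRL (s m) : ℝ)) ∧
      (∀ d : ℕ, (fun m => (zHB (s m) (c * Real.logb 2 (s m).length) : ℝ))
        =o[atTop] (fun m => (gIt d (s m) : ℝ))) := by
  have hf : ∀ m : ℕ, ∃ f : Fin (m + 2) → Fin (2 ^ (m + 2)), 64 ≤ m + 2 → ∀ d G,
      IsISLP d G (separatedPrefixes (segmentLengths (m + 2) f) (m + 2 + 1)) →
        (m + 2) ^ 2 / (16 * (Nat.log 2 (m + 2) + 1)) + 1 ≤ (G.map ItRule.size).sum := by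
    intro m
    by_cases h : 64 ≤ m + 2
    · obtain ⟨f, hf⟩ := exists_segmentLengths h
      exact ⟨f, fun _ => hf⟩
    · exact ⟨fun _ => ⟨0, by positivity⟩, fun h' => absurd h' h⟩
  choose f hf using hf
  let k : ℕ → ℕ → ℕ := fun m => segmentLengths (m + 2) (f m)
  let s : ℕ → List (Bool ⊕ ℕ) := fun m => separatedPrefixes (k m) (m + 2 + 1)
  have hk₁ : ∀ m, k m 1 = 2 ^ (m + 2) := fun m => segmentLengths_one _ _
  have hk : ∀ m i, 1 ≤ k m i ∧ k m i ≤ k m 1 := fun m i => by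
    rw [hk₁]
    exact segmentLengths_bounds _ _ i
  have hlog : ∀ m, Real.logb 2 (k m 1) = ((m + 2 : ℕ) : ℝ) := fun m => by
    rw [hk₁, Nat.cast_pow, Nat.cast_ofNat, Real.logb_pow, Real.logb_self_eq_one one_lt_two,
      mul_one]
  have hlen : ∀ m, 2 ^ (m + 2) ≤ (s m).length := fun m =>
    hk₁ m ▸ le_length_separatedPrefixes (k m) _
  have hne : ∀ m, s m ≠ [] := fun m =>
    List.length_pos_iff.1 (lt_of_lt_of_le (by positivity) (hlen m))
  -- The encoding has `2 m + 4` phrases for the first segment and `2 (m + 2)` for the others. Its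
  -- height is at most its size, hence at most `4 log n`.
  have henc : ∀ m, ∃ E, IsLZEncoding E (s m) ∧ E.length = 4 * (m + 2) := fun m => by
    obtain ⟨E, hE, hl⟩ := exists_isLZEncoding_separatedPrefixes (k m) m (m + 2) (hk₁ m)
      fun i _ _ => hk m i
    exact ⟨E, hE, by omega⟩
  have hz : ∀ m, lz77Size (s m) ≤ 4 * (m + 2) := fun m => by
    obtain ⟨E, hE, hl⟩ := henc m
    exact hl ▸ lz77Size_le hE
  have hzHB : ∀ m, zHB (s m) (4 * Real.logb 2 (s m).length) ≤ 4 * (m + 2) := fun m => by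
    obtain ⟨E, hE, hl⟩ := henc m
    have hn : ((m + 2 : ℕ) : ℝ) ≤ Real.logb 2 (s m).length := by
      rw [← hlog, hk₁]
      exact Real.logb_le_logb_of_le one_lt_two (by positivity) (by exact_mod_cast hlen m)
    refine hl ▸ zHB_le hE ?_
    rw [hl, Nat.cast_mul, Nat.cast_ofNat]
    linarith
  have hO : ∀ u : ℕ → ℕ, (∀ m, u m ≤ 4 * (m + 2)) →
      (fun m => (u m : ℝ)) =O[atTop] fun m : ℕ => ((m + 2 : ℕ) : ℝ) := fun u hu =>
    IsBigO.of_bound 4 <| Eventually.of_forall fun m => by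
      rw [Real.norm_natCast, Real.norm_natCast]
      exact_mod_cast hu m
  have hIt : ∀ᶠ m : ℕ in atTop, ∀ d : ℕ,
      1 / 32 * (((m + 2 : ℕ) : ℝ) ^ 2 / Real.logb 2 ((m + 2 : ℕ) : ℝ)) ≤ (gIt d (s m) : ℝ) := by
    filter_upwards [eventually_ge_atTop 62] with m hm d
    have hm' : 64 ≤ m + 2 := by omega
    exact (div_logb_le hm').trans (Nat.cast_le.2 (le_gIt (hne m) (hf m hm' d)))
  have hRL : ∀ᶠ m : ℕ in atTop,
      1 / 64 * (((m + 2 : ℕ) : ℝ) ^ 2 / Real.logb 2 ((m + 2 : ℕ) : ℝ)) ≤ (gRL (s m) : ℝ) := by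
    filter_upwards [eventually_ge_atTop 62] with m hm
    have hm' : 64 ≤ m + 2 := by omega
    have h := (div_logb_le hm').trans (Nat.cast_le.2 (le_two_mul_gRL (hne m) (hf m hm' 0)))
    rw [Nat.cast_mul, Nat.cast_ofNat] at h
    linarith
  refine ⟨fun m => m + 2 + 1, k, s, 4, fun m => rfl, fun m => ⟨Nat.le_add_left 1 _, fun i _ _ => hk m i⟩,
    ?_, ?_, by norm_num, ?_⟩
  · simp only [hk₁]
    exact (tendsto_pow_atTop_atTop_of_one_lt one_lt_two).comp (tendsto_add_atTop_nat 2)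
  · simp only [hlog]
    refine ⟨hO _ fun m => by omega, IsBigO.of_bound 1 (Eventually.of_forall fun m => ?_)⟩
    rw [Real.norm_natCast, Real.norm_natCast, one_mul]
    exact_mod_cast Nat.le_succ (m + 2)
  · simp only [hlog]
    exact ⟨hO _ hz, hO _ hzHB, ⟨1 / 64, by norm_num, hRL⟩, ⟨1 / 32, by norm_num, hIt⟩,
      isLittleO_of_le_of_ge (by norm_num) (hO _ hzHB) hRL,
      fun d => isLittleO_of_le_of_ge (by norm_num) (hO _ hzHB) (hIt.mono fun m h => h d)⟩
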